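/- Let $\mathcal H_A,\mathcal H_B$ be complex Hilbert spaces of finite dimensions $d_A,d_B\ge 1$, and let $\{A_i\}_{i=1}^{d_A^2}$, $\{B_j\}_{j=1}^{d_B^2}$ be any orthonormal bases (for the Hilbert–Schmidt inner product, $\operatorname{tr}(A_iA_j)=\delta_{ij}$, $\operatorname{tr}(B_iB_j)=\delta_{ij}$) of the real vector spaces of Hermitian operators on $\mathcal H_A$ and $\mathcal H_B$. For a state $\rho$ on $\mathcal H_A\otimes\mathcal H_B$ (a positive semidefinite operator of trace $1$) let $\mathcal C(\rho)$ be the real $d_A^2\times d_B^2$ correlation matrix $\mathcal C(\rho)_{ij}=\operatorname{tr}(\rho\,A_i\otimes B_j)$. For an integer $h$ with $1\le h\le\min\{d_A^2,d_B^2\}$ and a real $p\in[1,\infty)$, the Correlation Minor Norm is $\mathcal M_{h,p}(\rho)=\|C_h(\mathcal C(\rho))\|_p$, where $C_h(\cdot)$ denotes the $h$-th compound matrix (the matrix of all $h\times h$ minors) and $\|\cdot\|_p$ the Schatten $p$-norm (the $\ell^p$-norm of the vector of singular values). For an orthonormal basis $\{|l\rangle\}_{l=1}^{d_A}$ of $\mathcal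 H_A$, with $\Pi_l=|l\rangle\langle l|$, put $\Pi^A[\rho]=\sum_{l}(\Pi_l\otimes\mathbb 1)\,\rho\,(\Pi_l\otimes\mathbb 1)$, and define $$\mathcal D^A_{h,p}(\rho)=\mathcal M_{h,p}(\rho)^p-\max_{\Pi^A}\mathcal M_{h,p}(\Pi^A[\rho])^p,$$ the maximum being over all such projective measurements $\Pi^A$ on $A$. Let $$\mathcal D^A_G(\rho)=\min_{\chi}\|\rho-\chi\|^2$$ be the geometric quantum discord, where $\|\cdot\|$ is the Hilbert–Schmidt norm and $\chi$ ranges over the classical-quantum states $\chi=\sum_{i=1}^{d_A}q_i\,|i\rangle\langle i|\otimes\sigma_i$, with $\{|i\rangle\}$ an orthonormal basis of $\mathcal H_A$, $(q_i)$ a probability vector and $\sigma_i$ states on $\mathcal H_B$. Then, for every state $\rho$ and all such $h$ and $p$, the maximum and the minimum above are attained, and $$\mathcal D^A_{h,p}(\rho)\ge 0 .$$ Moreover, if $h\le 2$, then $\mathcal D^A_{h,p}(\rho)=0$ if and only if $\mathcal D^A_G(\rho)=0$. -/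

import Mathlib

open scoped Kronecker ComplexOrder

namespace CMN

/-- A density matrix: positive semidefinite with unit trace. -/
def IsState {n : Type*} [Fintype n] (ρ : Matrix n n ℂ) : Prop :=
  ρ.PosSemidef ∧ ρ.trace = 1

/-- `d ^ 2` Hermitian matrices of size `d × d` with `tr (A i * A j) = δ i j`. Since the real vector
space of Hermitian `d × d` matrices has dimension `d ^ 2`, such a family is exactly an orthonormal
basis of it for the Hilbert-Schmidt inner product. -/
structure IsObservableBasis {d : ℕ} (A : Fin (d ^ 2) → Matrix (Fin d) (Fin d) ℂ) : Prop where
  isHermitian : ∀ i, (A i).IsHermitian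
  trace_mul : ∀ i j, (A i * A j).trace = if i = j then 1 else 0

/-- The correlation matrix `C i j = tr (ρ (A i ⊗ B j))`. This trace is a real number, because `ρ`,
`A i` and `B j` are Hermitian; the real part only serves to get an entry of type `ℝ`. -/
noncomputable def correlationMatrix {dA dB : ℕ}
    (A : Fin (dA ^ 2) → Matrix (Fin dA) (Fin dA) ℂ)
    (B : Fin (dB ^ 2) → Matrix (Fin dB) (Fin dB) ℂ)
    (ρ : Matrix (Fin dA × Fin dB) (Fin dA × Fin dB) ℂ) :
    Matrix (Fin (dA ^ 2)) (Fin (dB ^ 2)) ℝ :=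
  Matrix.of fun i j => (ρ * (A i ⊗ₖ B j)).trace.re

/-- The `h`-th compound matrix: the matrix of all `h × h` minors, its rows and columns being indexed
by the `h`-element sets of row indices and of column indices. -/
noncomputable def compoundMatrix (h : ℕ) {m n : ℕ} (C : Matrix (Fin m) (Fin n) ℝ) :
    Matrix {R : Finset (Fin m) // R.card = h} {S : Finset (Fin n) // S.card = h} ℝ :=
  Matrix.of fun R S =>
    (C.submatrix (R.1.orderEmbOfFin R.2) (S.1.orderEmbOfFin S.2)).det

/-- The Schatten `p`-norm, i.e. the `p`-norm of the vector of singular values. Mathlib's sequence of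
singular values is nonincreasing and vanishes from the rank on, so that the terms with index below
the number of columns contain all nonzero ones. -/
noncomputable def schattenNorm (p : ℝ) {m n : Type*} [Fintype m] [Fintype n] [DecidableEq n]
    (M : Matrix m n ℝ) : ℝ :=
  (∑ k ∈ Finset.range (Fintype.card n), (Matrix.toEuclideanLin M).singularValues k ^ p) ^ (1 / p)

/-- The Correlation Minor Norm `M_{h,p}(ρ)`, computed in the bases of observables `A` and `B`. -/
noncomputable def cmn {dA dB : ℕ}
    (A : Fin (dA ^ 2) → Matrix (Fin dA) (Fin dA) ℂ)
    (B : Fin (dB ^ 2) → Matrix (Fin dB) (Fin dB) ℂ) (h : ℕ) (p : ℝ)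
    (ρ : Matrix (Fin dA × Fin dB) (Fin dA × Fin dB) ℂ) : ℝ :=
  schattenNorm p (compoundMatrix h (correlationMatrix A B ρ))

/-- The rank-one projection `|v⟩⟨v|` (for a unit vector `v`). -/
noncomputable def ketBra {d : ℕ} (v : EuclideanSpace ℂ (Fin d)) : Matrix (Fin d) (Fin d) ℂ :=
  Matrix.of fun i j => v i * star (v j)

/-- The state after a non-selective projective measurement on the first subsystem in the orthonormal
basis `e`: the sum over `l` of `(Π_l ⊗ 1) ρ (Π_l ⊗ 1)` with `Π_l = |e l⟩⟨e l|`. -/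
noncomputable def measureA {dA dB : ℕ}
    (e : OrthonormalBasis (Fin dA) ℂ (EuclideanSpace ℂ (Fin dA)))
    (ρ : Matrix (Fin dA × Fin dB) (Fin dA × Fin dB) ℂ) :
    Matrix (Fin dA × Fin dB) (Fin dA × Fin dB) ℂ :=
  ∑ l, (ketBra (e l) ⊗ₖ (1 : Matrix (Fin dB) (Fin dB) ℂ)) * ρ *
    (ketBra (e l) ⊗ₖ (1 : Matrix (Fin dB) (Fin dB) ℂ))

/-- The discord based on the Correlation Minor Norm, with respect to the first subsystem:
`M_{h,p}(ρ)^p` minus the maximum of `M_{h,p}(Π[ρ])^p` over the projective measurements `Π` on the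
first subsystem. -/
noncomputable def cmnDiscord {dA dB : ℕ}
    (A : Fin (dA ^ 2) → Matrix (Fin dA) (Fin dA) ℂ)
    (B : Fin (dB ^ 2) → Matrix (Fin dB) (Fin dB) ℂ) (h : ℕ) (p : ℝ)
    (ρ : Matrix (Fin dA × Fin dB) (Fin dA × Fin dB) ℂ) : ℝ :=
  cmn A B h p ρ ^ p -
    ⨆ e : OrthonormalBasis (Fin dA) ℂ (EuclideanSpace ℂ (Fin dA)), cmn A B h p (measureA e ρ) ^ p

/-- Classical-quantum states `∑ i, q i • |e i⟩⟨e i| ⊗ σ i`, where `e` is an orthonormal basis of the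
first space, `q` is a probability vector and the `σ i` are states of the second system. -/
def IsClassicalQuantum {dA dB : ℕ}
    (χ : Matrix (Fin dA × Fin dB) (Fin dA × Fin dB) ℂ) : Prop :=
  ∃ (e : OrthonormalBasis (Fin dA) ℂ (EuclideanSpace ℂ (Fin dA))) (q : Fin dA → ℝ)
    (σ : Fin dA → Matrix (Fin dB) (Fin dB) ℂ),
    (∀ i, 0 ≤ q i) ∧ ∑ i, q i = 1 ∧ (∀ i, IsState (σ i)) ∧
      χ = ∑ i, (q i : ℂ) • (ketBra (e i) ⊗ₖ σ i)

/-- The squared Hilbert-Schmidt (Euclidean) norm of a matrix. -/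
noncomputable def hsNormSq {n : Type*} [Fintype n] (M : Matrix n n ℂ) : ℝ :=
  ∑ i, ∑ j, ‖M i j‖ ^ 2

/-- The geometric quantum discord with respect to the first subsystem: the minimum of `‖ρ - χ‖ ^ 2`
over the classical-quantum states `χ`. -/
noncomputable def geometricDiscord {dA dB : ℕ}
    (ρ : Matrix (Fin dA × Fin dB) (Fin dA × Fin dB) ℂ) : ℝ :=
  ⨅ χ : {χ : Matrix (Fin dA × Fin dB) (Fin dA × Fin dB) ℂ // IsClassicalQuantum χ},
    hsNormSq (ρ - χ.1)

end CMN

/-!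
In bases of observables, measuring the first subsystem multiplies the correlation matrix `C` of `ρ`
from the left by the matrix `P` of the dephasing map, which is a real orthogonal projection
(`transpose_dephasingMatrix`, `dephasingMatrix_mul_self`, `correlationMatrix_measureA`). By the
Cauchy-Binet formula (`compoundMatrix_mul`), the compound matrix of `P` is again an orthogonal
projection `Q`, and the norm after the measurement is `‖Q * X‖` with `X` the compound matrix of `C`.
Since `Q` is a contraction, every singular value of `Q * X` is at most the corresponding one of `X`
(`LinearMap.singularValues_le_add`), so that the discord is nonnegative.

If the discord vanishes, then `Q * X` and `X` have the same singular values, hence the same Frobenius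
norm, and `Q * X = X` (`mul_eq_self_of_schattenNorm_rpow_eq`). For order one this says `P * C = C`.
For order two the `2 × 2` minors of `P * C` and `C` agree; applying `1 - P` to a row of them shows
that `P * C = C` or `C` has rank one (`mul_eq_self_or_exists_vecMulVec`). In the former case the
measurement leaves `ρ` undisturbed, in the latter `ρ` is a product and the measurement in an
eigenbasis of its first factor does. Undisturbed states are exactly the classical-quantum ones
(`isClassicalQuantum_iff`), that is, those of vanishing geometric discord.

Both extrema are attained because orthonormal families form a compact set: singular values are
Lipschitz continuous, by the same inequality that gives their monotonicity, and the
classical-quantum states form a closed set, as a projection along a compact factor.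
-/

/-! ### Singular values and Schatten norms -/

namespace LinearMap

variable {𝕜 E F G : Type*} [RCLike 𝕜]
  [NormedAddCommGroup E] [InnerProductSpace 𝕜 E] [FiniteDimensional 𝕜 E]
  [NormedAddCommGroup F] [InnerProductSpace 𝕜 F] [FiniteDimensional 𝕜 F]
  [NormedAddCommGroup G] [InnerProductSpace 𝕜 G] [FiniteDimensional 𝕜 G]

/-- The singular value decomposition, read off as a sum over the right singular vectors. -/
theorem norm_sq_apply_eq_sum_singularValues (T : E →ₗ[𝕜] F) {n : ℕ}
    (hn : Module.finrank 𝕜 E = n) (x : E) :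
    ‖T x‖ ^ 2 = ∑ i : Fin n, (T.singularValues i) ^ 2 *
      ‖(T.isSymmetric_adjoint_comp_self.eigenvectorBasis hn).repr x i‖ ^ 2 := by
  set b := T.isSymmetric_adjoint_comp_self.eigenvectorBasis hn with hb
  have h1 : inner 𝕜 (T x) (T x) = inner 𝕜 (b.repr ((adjoint T ∘ₗ T) x)) (b.repr x) := by
    rw [LinearIsometryEquiv.inner_map_map, LinearMap.comp_apply, LinearMap.adjoint_inner_left]
  rw [← @RCLike.ofReal_inj 𝕜, RCLike.ofReal_pow, ← inner_self_eq_norm_sq_to_K, h1,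
    PiLp.inner_apply, RCLike.ofReal_sum]
  refine Finset.sum_congr rfl fun i _ => ?_
  rw [hb, IsSymmetric.eigenvectorBasis_apply_self_apply, ← hb, T.sq_singularValues_fin hn,
    ← smul_eq_mul, inner_smul_left, inner_self_eq_norm_sq_to_K]
  simp

/-- A Weyl-type inequality. It comes from the min-max principle: some nonzero `x` is orthogonal both
to the right singular vectors of `S` after the `k`-th and to those of `T` before the `k`-th. -/
theorem singularValues_le_add (S : E →ₗ[𝕜] G) (T : E →ₗ[𝕜] F) {ε : ℝ} (hε : 0 ≤ ε)
    (h : ∀ x, ‖S x‖ ≤ ‖T x‖ + ε * ‖x‖) (k : ℕ) :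
    S.singularValues k ≤ T.singularValues k + ε := by
  rcases le_or_gt (Module.finrank 𝕜 E) k with hk | hk
  · rw [S.singularValues_of_finrank_le hk]
    exact add_nonneg (T.singularValues_nonneg k) hε
  set n := Module.finrank 𝕜 E with hn
  set bS := S.isSymmetric_adjoint_comp_self.eigenvectorBasis hn.symm with hbS
  set bT := T.isSymmetric_adjoint_comp_self.eigenvectorBasis hn.symm with hbT
  -- The `n - 1` linear forms that vanish on the vector sought.
  let g : E →ₗ[𝕜] ({i : Fin n // i ≠ ⟨k, hk⟩} → 𝕜) := LinearMap.pi fun i =>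
    if k < i.1 then bS.toBasis.coord i.1 else bT.toBasis.coord i.1
  obtain ⟨x, hx, hx0⟩ : ∃ x, g x = 0 ∧ x ≠ 0 := by
    have : LinearMap.ker g ≠ ⊥ := by
      apply LinearMap.ker_ne_bot_of_finrank_lt
      rw [Module.finrank_fintype_fun_eq_card, Fintype.card_subtype_compl, Fintype.card_fin,
        Fintype.card_subtype_eq, ← hn]
      omega
    obtain ⟨x, hx, hx0⟩ := (LinearMap.ker g).ne_bot_iff.1 this
    exact ⟨x, hx, hx0⟩
  have hxS : ∀ i : Fin n, k < i → bS.repr x i = 0 := fun i hi => by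
    have := congrFun hx ⟨i, fun h => by simp [h] at hi⟩
    simpa [g, hi] using this
  have hxT : ∀ i : Fin n, (i : ℕ) < k → bT.repr x i = 0 := fun i hi => by
    have := congrFun hx ⟨i, fun h => by simp [h] at hi⟩
    simpa [g, hi.not_gt] using this
  have hSx : S.singularValues k * ‖x‖ ≤ ‖S x‖ := by
    refine le_of_sq_le_sq ?_ (norm_nonneg _)
    rw [S.norm_sq_apply_eq_sum_singularValues hn.symm, mul_pow, ← bS.repr.norm_map x,
      EuclideanSpace.norm_sq_eq, Finset.mul_sum]
    refine Finset.sum_le_sum fun i _ => ?_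
    rcases lt_or_ge k i with hi | hi
    · simp [← hbS, hxS i hi]
    · gcongr
      exacts [S.singularValues_nonneg k, S.singularValues_antitone hi]
  have hTx : ‖T x‖ ≤ T.singularValues k * ‖x‖ := by
    refine le_of_sq_le_sq ?_ (mul_nonneg (T.singularValues_nonneg k) (norm_nonneg _))
    rw [T.norm_sq_apply_eq_sum_singularValues hn.symm, mul_pow, ← bT.repr.norm_map x,
      EuclideanSpace.norm_sq_eq, Finset.mul_sum]
    refine Finset.sum_le_sum fun i _ => ?_
    rcases lt_or_ge (i : ℕ) k with hi | hi
    · simp [← hbT, hxT i hi]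
    · gcongr
      exacts [T.singularValues_nonneg i, T.singularValues_antitone hi]
  have := h x
  refine le_of_mul_le_mul_right ?_ (norm_pos_iff.2 hx0)
  linarith

theorem singularValues_mono (S : E →ₗ[𝕜] G) (T : E →ₗ[𝕜] F) (h : ∀ x, ‖S x‖ ≤ ‖T x‖) (k : ℕ) :
    S.singularValues k ≤ T.singularValues k := by
  simpa using singularValues_le_add S T le_rfl (by simpa using h) k

theorem abs_singularValues_sub_le (S T : E →ₗ[𝕜] F) (k : ℕ) :
    |S.singularValues k - T.singularValues k| ≤ ‖(S - T).toContinuousLinearMap‖ := by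
  have key : ∀ S T : E →ₗ[𝕜] F,
      S.singularValues k ≤ T.singularValues k + ‖(S - T).toContinuousLinearMap‖ := by
    intro S T
    refine singularValues_le_add S T (norm_nonneg _) (fun x => ?_) k
    calc ‖S x‖ = ‖T x + (S - T) x‖ := by simp
      _ ≤ _ := (norm_add_le _ _).trans (by
        gcongr
        exact (S - T).toContinuousLinearMap.le_opNorm x)
  rw [abs_sub_le_iff]
  refine ⟨by linarith [key S T], ?_⟩
  have : (T - S).toContinuousLinearMap = -(S - T).toContinuousLinearMap := by
    ext; simp
  have h2 := key T S
  rw [this, norm_neg] at h2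
  linarith

theorem sum_sq_singularValues (T : E →ₗ[𝕜] F) :
    ((∑ k ∈ Finset.range (Module.finrank 𝕜 E), T.singularValues k ^ 2 : ℝ) : 𝕜) =
      trace 𝕜 E (adjoint T ∘ₗ T) := by
  rw [Finset.sum_range, T.isSymmetric_adjoint_comp_self.trace_eq_sum_eigenvalues rfl]
  push_cast
  exact Finset.sum_congr rfl fun i _ => by rw [← T.sq_singularValues_fin rfl]; simp

end LinearMap

namespace CMN

open Matrix

variable {m n : Type*} [Fintype m] [Fintype n] [DecidableEq n]

theorem schattenNorm_rpow {p : ℝ} (hp : p ≠ 0) (M : Matrix m n ℝ) :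
    schattenNorm p M ^ p =
      ∑ k ∈ Finset.range (Fintype.card n), (toEuclideanLin M).singularValues k ^ p := by
  rw [schattenNorm, ← Real.rpow_mul (Finset.sum_nonneg fun k _ =>
    Real.rpow_nonneg (LinearMap.singularValues_nonneg _ _) _), one_div_mul_cancel hp,
    Real.rpow_one]

theorem continuous_singularValues_toEuclideanLin (k : ℕ) :
    Continuous fun M : Matrix m n ℝ => (toEuclideanLin M).singularValues k := by
  let φ : Matrix m n ℝ →ₗ[ℝ] (EuclideanSpace ℝ n →L[ℝ] EuclideanSpace ℝ m) :=
    LinearMap.toContinuousLinearMap.toLinearMap ∘ₗ toEuclideanLin.toLinearMap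
  have hφ : Continuous φ := φ.continuous_of_finiteDimensional
  refine continuous_iff_continuousAt.2 fun M => ?_
  refine tendsto_iff_dist_tendsto_zero.2 ?_
  refine squeeze_zero (fun _ => dist_nonneg) (g := fun N => ‖φ N - φ M‖) (fun N => ?_) ?_
  · have := LinearMap.abs_singularValues_sub_le (toEuclideanLin N) (toEuclideanLin M) k
    rwa [map_sub] at this
  · have : Continuous fun N => ‖φ N - φ M‖ := by fun_prop
    simpa using this.tendsto M

theorem continuous_schattenNorm_rpow {p : ℝ} (hp : 0 < p) :
    Continuous fun M : Matrix m n ℝ => schattenNorm p M ^ p := by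
  simp_rw [schattenNorm_rpow hp.ne']
  exact continuous_finsetSum _ fun k _ =>
    (continuous_singularValues_toEuclideanLin k).rpow_const fun _ => Or.inr hp.le

variable [DecidableEq m]

theorem sum_sq_singularValues_toEuclideanLin (M : Matrix m n ℝ) :
    ∑ k ∈ Finset.range (Fintype.card n), (toEuclideanLin M).singularValues k ^ 2 =
      (Mᵀ * M).trace := by
  have h := LinearMap.sum_sq_singularValues (toEuclideanLin M)
  rw [← toEuclideanLin_conjTranspose_eq_adjoint, finrank_euclideanSpace] at h
  simp only [RCLike.ofReal_real_eq_id, id] at h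
  rw [h, conjTranspose_eq_transpose_of_trivial]
  have : toEuclideanLin Mᵀ ∘ₗ toEuclideanLin M = toEuclideanLin (Mᵀ * M) := by
    ext; simp [toLpLin_apply]
  rw [this]
  simp [toEuclideanLin_eq_toLin_orthonormal, trace_toLin_eq]

theorem norm_toEuclideanLin_mul_le {Q : Matrix m m ℝ} (hQ : Qᵀ = Q) (hQQ : Q * Q = Q)
    (X : Matrix m n ℝ) (v : EuclideanSpace ℝ n) :
    ‖toEuclideanLin (Q * X) v‖ ≤ ‖toEuclideanLin X v‖ := by
  set y := toEuclideanLin X v with hy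
  have h1 : toEuclideanLin (Q * X) v = toEuclideanLin Q y := by simp [hy, toLpLin_apply]
  rw [h1]
  have h2 : ‖toEuclideanLin Q y‖ ^ 2 ≤ ‖y‖ * ‖toEuclideanLin Q y‖ := by
    have : inner ℝ (toEuclideanLin Q y) (toEuclideanLin Q y) = inner ℝ y (toEuclideanLin Q y) := by
      rw [← LinearMap.adjoint_inner_right, ← toEuclideanLin_conjTranspose_eq_adjoint,
        conjTranspose_eq_transpose_of_trivial, hQ]
      congr 1
      simp [toLpLin_apply, hQQ]
    rw [← real_inner_self_eq_norm_sq, this]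
    exact real_inner_le_norm _ _
  by_contra! hlt
  nlinarith [norm_nonneg y]

theorem schattenNorm_mul_rpow_le {p : ℝ} (hp : 0 < p) {Q : Matrix m m ℝ} (hQ : Qᵀ = Q)
    (hQQ : Q * Q = Q) (X : Matrix m n ℝ) :
    schattenNorm p (Q * X) ^ p ≤ schattenNorm p X ^ p := by
  rw [schattenNorm_rpow hp.ne', schattenNorm_rpow hp.ne']
  exact Finset.sum_le_sum fun k _ => Real.rpow_le_rpow (LinearMap.singularValues_nonneg _ _)
    (LinearMap.singularValues_mono _ _ (norm_toEuclideanLin_mul_le hQ hQQ X) k) hp.le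

/-- A projection that preserves the Schatten norm of `X` preserves every singular value, hence the
Frobenius norm of `X`, and so it fixes `X` by Pythagoras. -/
theorem mul_eq_self_of_schattenNorm_rpow_eq {p : ℝ} (hp : 0 < p) {Q : Matrix m m ℝ} (hQ : Qᵀ = Q)
    (hQQ : Q * Q = Q) (X : Matrix m n ℝ)
    (h : schattenNorm p (Q * X) ^ p = schattenNorm p X ^ p) : Q * X = X := by
  have hle := LinearMap.singularValues_mono _ _ (norm_toEuclideanLin_mul_le hQ hQQ X)
  rw [schattenNorm_rpow hp.ne', schattenNorm_rpow hp.ne', Finset.sum_eq_sum_iff_of_le fun k _ =>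
    Real.rpow_le_rpow (LinearMap.singularValues_nonneg _ _) (hle k) hp.le] at h
  have h2 : ((Q * X)ᵀ * (Q * X)).trace = (Xᵀ * X).trace := by
    rw [← sum_sq_singularValues_toEuclideanLin, ← sum_sq_singularValues_toEuclideanLin]
    refine Finset.sum_congr rfl fun k hk => ?_
    rw [(Real.rpow_left_inj (LinearMap.singularValues_nonneg _ _)
      (LinearMap.singularValues_nonneg _ _) hp.ne').1 (h k hk)]
  have h3 : ((X - Q * X)ᴴ * (X - Q * X)).trace = 0 := by
    have e1 : (Q * X)ᵀ * (Q * X) = Xᵀ * (Q * X) := by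
      rw [transpose_mul, hQ, Matrix.mul_assoc, ← Matrix.mul_assoc Q, hQQ]
    have e2 : (Q * X)ᵀ * X = Xᵀ * (Q * X) := by
      rw [transpose_mul, hQ, Matrix.mul_assoc]
    rw [conjTranspose_eq_transpose_of_trivial, transpose_sub, Matrix.sub_mul, Matrix.mul_sub,
      Matrix.mul_sub, e1, e2,
      sub_self, sub_zero, trace_sub, ← h2, e1, sub_self]
  exact (sub_eq_zero.1 (trace_conjTranspose_mul_self_eq_zero_iff.1 h3)).symm

end CMN

/-! ### Compound matrices -/

namespace CMN

open Matrix

variable {l m n : ℕ}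

/-- The entries of the compound matrix are those of the induced map of exterior powers. -/
theorem compoundMatrix_eq_toMatrix_apply (h : ℕ) (M : Matrix (Fin m) (Fin n) ℝ)
    (R : Set.powersetCard (Fin m) h) (S : Set.powersetCard (Fin n) h) :
    compoundMatrix h M ⟨R.1, R.2⟩ ⟨S.1, S.2⟩ =
      LinearMap.toMatrix ((Pi.basisFun ℝ (Fin n)).exteriorPower h)
        ((Pi.basisFun ℝ (Fin m)).exteriorPower h) (exteriorPower.map h (toLin' M)) R S := by
  rw [LinearMap.toMatrix_apply, exteriorPower.basis_repr_apply, exteriorPower.basis_apply,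
    exteriorPower.map_apply_ιMulti_family, exteriorPower.ιMulti_family,
    exteriorPower.ιMultiDual_apply_ιMulti, compoundMatrix, of_apply, ← det_transpose]
  congr 1
  ext i j
  simp [Set.powersetCard.ofFinEmbEquiv_symm_apply]

/-- The Cauchy-Binet formula, from the functoriality of exterior powers. -/
theorem compoundMatrix_mul (h : ℕ) (M : Matrix (Fin l) (Fin m) ℝ) (N : Matrix (Fin m) (Fin n) ℝ) :
    compoundMatrix h (M * N) = compoundMatrix h M * compoundMatrix h N := by
  ext ⟨R, hR⟩ ⟨S, hS⟩
  let R' : Set.powersetCard (Fin l) h := ⟨R, hR⟩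
  let S' : Set.powersetCard (Fin n) h := ⟨S, hS⟩
  refine (compoundMatrix_eq_toMatrix_apply h (M * N) R' S').trans ?_
  rw [toLin'_mul, exteriorPower.map_comp, LinearMap.toMatrix_comp
    ((Pi.basisFun ℝ (Fin n)).exteriorPower h) ((Pi.basisFun ℝ (Fin m)).exteriorPower h)
    ((Pi.basisFun ℝ (Fin l)).exteriorPower h), mul_apply, mul_apply]
  let e : Set.powersetCard (Fin m) h ≃ {T : Finset (Fin m) // T.card = h} := Equiv.refl _
  refine Fintype.sum_equiv e _ _ fun T => ?_
  rw [← compoundMatrix_eq_toMatrix_apply, ← compoundMatrix_eq_toMatrix_apply]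
  rfl

theorem transpose_compoundMatrix (h : ℕ) (M : Matrix (Fin m) (Fin n) ℝ) :
    (compoundMatrix h M)ᵀ = compoundMatrix h Mᵀ := by
  ext R S
  simp only [compoundMatrix, transpose_apply, of_apply]
  rw [← det_transpose]
  rfl

theorem continuous_compoundMatrix (h : ℕ) :
    Continuous (compoundMatrix h : Matrix (Fin m) (Fin n) ℝ → _) := by
  refine continuous_matrix fun R S => ?_
  exact Continuous.matrix_det (by fun_prop)

theorem eq_of_compoundMatrix_one_eq {M N : Matrix (Fin m) (Fin n) ℝ}
    (h : compoundMatrix 1 M = compoundMatrix 1 N) : M = N := by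
  ext i j
  have := congrFun (congrFun h ⟨{i}, Finset.card_singleton i⟩) ⟨{j}, Finset.card_singleton j⟩
  simpa [compoundMatrix] using this

/-- Equality of the second compound matrices gives equality of the `2 × 2` minors with rows and
columns in any order, repetitions included. -/
theorem minor_eq_of_compoundMatrix_two_eq {M N : Matrix (Fin m) (Fin n) ℝ}
    (h : compoundMatrix 2 M = compoundMatrix 2 N) (i i' : Fin m) (j j' : Fin n) :
    M i j * M i' j' - M i j' * M i' j = N i j * N i' j' - N i j' * N i' j := by
  have key : ∀ i i' j j', i < i' → j < j' →
      M i j * M i' j' - M i j' * M i' j = N i j * N i' j' - N i j' * N i' j := by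
    intro i i' j j' hi hj
    have := congrFun (congrFun h ⟨{i, i'}, Finset.card_pair hi.ne⟩)
      ⟨{j, j'}, Finset.card_pair hj.ne⟩
    have emb : ∀ {k : ℕ} {a b : Fin k} (hab : a < b),
        (({a, b} : Finset (Fin k)).orderEmbOfFin (Finset.card_pair hab.ne) : Fin 2 → Fin k) =
          ![a, b] := by
      intro k a b hab
      refine (Finset.orderEmbOfFin_unique _ (fun x => ?_) ?_).symm
      · fin_cases x <;> simp
      · intro x y hxy
        fin_cases x <;> fin_cases y <;> simp_all
    simpa [compoundMatrix, det_fin_two, emb hi, emb hj] using this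
  rcases lt_trichotomy i i' with hi | rfl | hi <;> rcases lt_trichotomy j j' with hj | rfl | hj
  · exact key _ _ _ _ hi hj
  · ring
  · linarith [key _ _ _ _ hi hj]
  · ring
  · ring
  · ring
  · linarith [key _ _ _ _ hi hj]
  · ring
  · linarith [key _ _ _ _ hi hj]

/-- If a projection `P` does not change the `2 × 2` minors of `C`, it fixes `C` unless `C` has rank
at most one. -/
theorem mul_eq_self_or_exists_vecMulVec {P : Matrix (Fin m) (Fin m) ℝ} (hP : P * P = P)
    {C : Matrix (Fin m) (Fin n) ℝ} (h : compoundMatrix 2 (P * C) = compoundMatrix 2 C) :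
    P * C = C ∨ ∃ a b, C = vecMulVec a b := by
  by_cases hPC : P * C = C
  · exact Or.inl hPC
  right
  set D := (1 - P) * C with hD
  -- `1 - P` acting on the first row of the minors annihilates those of `P * C`.
  have key : ∀ k i' j j', D k j * C i' j' - D k j' * C i' j = 0 := by
    intro k i' j j'
    have hzero : (1 - P) * (P * C) = 0 := by
      rw [← Matrix.mul_assoc, Matrix.sub_mul, one_mul, hP, sub_self, Matrix.zero_mul]
    have e : ∀ Y : Matrix (Fin m) (Fin n) ℝ,
        ((1 - P) * Y : Matrix (Fin m) (Fin n) ℝ) k j * Y i' j' -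
          ((1 - P) * Y : Matrix (Fin m) (Fin n) ℝ) k j' * Y i' j =
          ∑ i, (1 - P) k i * (Y i j * Y i' j' - Y i j' * Y i' j) := by
      intro Y
      simp only [mul_apply, Finset.sum_mul, ← Finset.sum_sub_distrib]
      exact Finset.sum_congr rfl fun i _ => by ring
    rw [hD, e C, ← Finset.sum_congr rfl fun i _ =>
      congrArg ((1 - P) k i * ·) (minor_eq_of_compoundMatrix_two_eq h i i' j j'), ← e (P * C), hzero]
    simp
  obtain ⟨k, j, hkj⟩ : ∃ k j, D k j ≠ 0 := by
    by_contra! h0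
    apply hPC
    have : D = 0 := by ext k j; exact h0 k j
    rw [hD, Matrix.sub_mul, Matrix.one_mul, sub_eq_zero] at this
    exact this.symm
  refine ⟨fun i => C i j, fun j' => D k j' / D k j, ?_⟩
  ext i j'
  have := key k i j j'
  rw [vecMulVec_apply]
  field_simp
  linarith

end CMN

/-! ### Orthonormal families of observables and the correlation matrix -/

namespace CMN

open Matrix

theorem ofReal_re_trace_mul {n : Type*} [Fintype n] {X Y : Matrix n n ℂ} (hX : X.IsHermitian)
    (hY : Y.IsHermitian) : (((X * Y).trace.re : ℝ) : ℂ) = (X * Y).trace := by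
  refine Complex.conj_eq_iff_re.1 ?_
  rw [starRingEnd_apply, ← trace_conjTranspose, conjTranspose_mul, hX.eq, hY.eq, trace_mul_comm]

/-- A trace-orthonormal family of full cardinality is a basis, with respect to which every matrix
has its traces as coefficients. -/
theorem eq_sum_trace_mul_smul {ι n : Type*} [Fintype ι] [DecidableEq ι] [Fintype n]
    {A : ι → Matrix n n ℂ} (hcard : Fintype.card ι = Fintype.card n ^ 2)
    (hA : ∀ i j, (A i * A j).trace = if i = j then 1 else 0) (X : Matrix n n ℂ) :
    X = ∑ i, (X * A i).trace • A i := by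
  have hcoef : ∀ (c : ι → ℂ) j, ((∑ i, c i • A i) * A j).trace = c j := by
    intro c j
    simp [Finset.sum_mul, trace_sum, hA]
  have hli : LinearIndependent ℂ A := by
    rw [Fintype.linearIndependent_iff]
    intro c hc j
    rw [← hcoef c j, hc]
    simp
  have hspan := hli.span_eq_top_of_card_eq_finrank' (by
    rw [hcard, Module.finrank_matrix, Module.finrank_self]; ring)
  have hX : X ∈ Submodule.span ℂ (Set.range A) := hspan ▸ Submodule.mem_top
  obtain ⟨c, rfl⟩ := (Submodule.mem_span_range_iff_exists_fun ℂ).1 hX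
  simp_rw [hcoef]

theorem sum_smul_kronecker {ι m n : Type*} [Fintype ι] (c : ι → ℂ) (X : ι → Matrix m m ℂ)
    (Y : Matrix n n ℂ) : (∑ i, c i • X i) ⊗ₖ Y = ∑ i, c i • (X i ⊗ₖ Y) := by
  ext
  simp [Matrix.sum_apply, Finset.sum_mul, mul_assoc]

variable {dA dB : ℕ} {A : Fin (dA ^ 2) → Matrix (Fin dA) (Fin dA) ℂ}
  {B : Fin (dB ^ 2) → Matrix (Fin dB) (Fin dB) ℂ}
  {ρ : Matrix (Fin dA × Fin dB) (Fin dA × Fin dB) ℂ}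

theorem IsObservableBasis.eq_sum (hA : IsObservableBasis A) (X : Matrix (Fin dA) (Fin dA) ℂ) :
    X = ∑ i, (X * A i).trace • A i :=
  eq_sum_trace_mul_smul (by simp) hA.trace_mul X

theorem isHermitian_kronecker {m n : Type*} {X : Matrix m m ℂ} {Y : Matrix n n ℂ}
    (hX : X.IsHermitian) (hY : Y.IsHermitian) : (X ⊗ₖ Y).IsHermitian := by
  rw [IsHermitian, conjTranspose_kronecker, hX.eq, hY.eq]

theorem ofReal_correlationMatrix (hA : IsObservableBasis A) (hB : IsObservableBasis B)
    (hρ : ρ.IsHermitian) (i : Fin (dA ^ 2)) (j : Fin (dB ^ 2)) :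
    ((correlationMatrix A B ρ i j : ℝ) : ℂ) = (ρ * (A i ⊗ₖ B j)).trace :=
  ofReal_re_trace_mul hρ (isHermitian_kronecker (hA.isHermitian i) (hB.isHermitian j))

theorem eq_sum_correlationMatrix (hA : IsObservableBasis A) (hB : IsObservableBasis B)
    (hρ : ρ.IsHermitian) :
    ρ = ∑ i, ∑ j, (correlationMatrix A B ρ i j : ℂ) • (A i ⊗ₖ B j) := by
  have h := eq_sum_trace_mul_smul (A := fun k : Fin (dA ^ 2) × Fin (dB ^ 2) => A k.1 ⊗ₖ B k.2)
    (by simp; ring) (fun i j => by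
      rw [← mul_kronecker_mul, trace_kronecker, hA.trace_mul, hB.trace_mul]
      simp only [Prod.ext_iff]
      split_ifs <;> simp_all) ρ
  rw [Fintype.sum_prod_type] at h
  simp_rw [ofReal_correlationMatrix hA hB hρ]
  exact h

theorem correlationMatrix_injective (hA : IsObservableBasis A) (hB : IsObservableBasis B)
    {ρ' : Matrix (Fin dA × Fin dB) (Fin dA × Fin dB) ℂ} (hρ : ρ.IsHermitian)
    (hρ' : ρ'.IsHermitian) (h : correlationMatrix A B ρ = correlationMatrix A B ρ') : ρ = ρ' := by
  rw [eq_sum_correlationMatrix hA hB hρ, eq_sum_correlationMatrix hA hB hρ', h]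

/-! ### Dephasing in an orthonormal basis -/

section Dephasing

variable {d : ℕ} {v w : EuclideanSpace ℂ (Fin d)}

theorem isHermitian_ketBra (v : EuclideanSpace ℂ (Fin d)) : (ketBra v).IsHermitian := by
  ext i j
  simp [ketBra, mul_comm]

theorem ketBra_mul_ketBra (v w : EuclideanSpace ℂ (Fin d)) :
    ketBra v * ketBra w = inner ℂ v w • Matrix.of fun i j => v i * star (w j) := by
  ext i j
  simp only [ketBra, mul_apply, of_apply, Matrix.smul_apply, PiLp.inner_apply, smul_eq_mul,
    Finset.sum_mul, RCLike.inner_apply]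
  refine Finset.sum_congr rfl fun k _ => ?_
  simp
  ring

theorem ketBra_mul_self (hv : ‖v‖ = 1) : ketBra v * ketBra v = ketBra v := by
  rw [ketBra_mul_ketBra, inner_self_eq_norm_sq_to_K, hv]
  simp [ketBra]

theorem ketBra_mul_eq_zero (h : inner ℂ v w = 0) : ketBra v * ketBra w = 0 := by
  rw [ketBra_mul_ketBra, h, zero_smul]

theorem trace_ketBra (hv : ‖v‖ = 1) : (ketBra v).trace = 1 := by
  have : (ketBra v).trace = inner ℂ v v := by
    simp [trace, ketBra, PiLp.inner_apply, -inner_self_eq_norm_sq_to_K]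
  rw [this, inner_self_eq_norm_sq_to_K, hv]
  simp

theorem posSemidef_ketBra (v : EuclideanSpace ℂ (Fin d)) : (ketBra v).PosSemidef :=
  posSemidef_vecMulVec_self_star (v : Fin d → ℂ)

variable (e : OrthonormalBasis (Fin d) ℂ (EuclideanSpace ℂ (Fin d)))

theorem ketBra_mul_ketBra_basis (l k : Fin d) :
    ketBra (e l) * ketBra (e k) = if l = k then ketBra (e l) else 0 := by
  split_ifs with h
  · rw [h, ketBra_mul_self (e.orthonormal.1 k)]
  · exact ketBra_mul_eq_zero (e.orthonormal.2 h)

theorem sum_ketBra : ∑ l, ketBra (e l) = 1 := by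
  ext i j
  have h := congrArg (fun x : EuclideanSpace ℂ (Fin d) => x i)
    (e.sum_repr' (EuclideanSpace.single j 1))
  simp only [Matrix.sum_apply, ketBra, of_apply]
  simpa [EuclideanSpace.inner_single_right, Matrix.one_apply, mul_comm, Pi.single_apply, eq_comm]
    using h

/-- The dephasing map `X ↦ ∑ l, |e l⟩⟨e l| X |e l⟩⟨e l|` on matrices. -/
noncomputable def dephase (X : Matrix (Fin d) (Fin d) ℂ) : Matrix (Fin d) (Fin d) ℂ :=
  ∑ l, ketBra (e l) * X * ketBra (e l)

theorem isHermitian_dephase {X : Matrix (Fin d) (Fin d) ℂ} (hX : X.IsHermitian) :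
    (dephase e X).IsHermitian := by
  rw [IsHermitian, dephase, conjTranspose_sum]
  refine Finset.sum_congr rfl fun l _ => ?_
  rw [conjTranspose_mul, conjTranspose_mul, (isHermitian_ketBra _).eq, hX.eq, Matrix.mul_assoc]

theorem trace_dephase_mul (X Y : Matrix (Fin d) (Fin d) ℂ) :
    (dephase e X * Y).trace = (X * dephase e Y).trace := by
  simp only [dephase, Finset.sum_mul, Finset.mul_sum, trace_sum]
  refine Finset.sum_congr rfl fun l _ => ?_
  rw [Matrix.mul_assoc, Matrix.mul_assoc, trace_mul_comm]
  simp only [Matrix.mul_assoc]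

theorem dephase_dephase (X : Matrix (Fin d) (Fin d) ℂ) :
    dephase e (dephase e X) = dephase e X := by
  simp only [dephase]
  refine Finset.sum_congr rfl fun l _ => ?_
  rw [Finset.mul_sum, Finset.sum_mul, Finset.sum_eq_single l]
  · rw [← Matrix.mul_assoc, ← Matrix.mul_assoc, ketBra_mul_self (e.orthonormal.1 l),
      Matrix.mul_assoc, ketBra_mul_self (e.orthonormal.1 l)]
  · intro k _ hk
    rw [← Matrix.mul_assoc, ← Matrix.mul_assoc, ketBra_mul_ketBra_basis, if_neg hk.symm]
    simp
  · simp

/-- Dephasing in an eigenbasis fixes a Hermitian matrix. -/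
theorem dephase_eigenvectorBasis {X : Matrix (Fin d) (Fin d) ℂ} (hX : X.IsHermitian) :
    dephase hX.eigenvectorBasis X = X := by
  have h : ∀ l, ketBra (hX.eigenvectorBasis l) * X * ketBra (hX.eigenvectorBasis l) =
      X * ketBra (hX.eigenvectorBasis l) := by
    intro l
    have : X * ketBra (hX.eigenvectorBasis l) =
        (hX.eigenvalues l : ℂ) • ketBra (hX.eigenvectorBasis l) := by
      ext i j
      have h := congrFun (hX.mulVec_eigenvectorBasis l) i
      have h2 : (X * ketBra (hX.eigenvectorBasis l)) i j =
          (X *ᵥ (hX.eigenvectorBasis l)) i * star (hX.eigenvectorBasis l j) := by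
        simp [mul_apply, ketBra, mulVec, dotProduct, Finset.sum_mul, mul_assoc]
      rw [h2, h]
      simp [ketBra, mul_assoc]
    rw [Matrix.mul_assoc, this, Matrix.mul_smul,
      ketBra_mul_self (hX.eigenvectorBasis.orthonormal.1 l)]
  rw [dephase, Finset.sum_congr rfl fun l _ => h l, ← Finset.mul_sum, sum_ketBra, mul_one]

end Dephasing

/-- The matrix of the dephasing map in a basis of observables. -/
noncomputable def dephasingMatrix (A : Fin (dA ^ 2) → Matrix (Fin dA) (Fin dA) ℂ)
    (e : OrthonormalBasis (Fin dA) ℂ (EuclideanSpace ℂ (Fin dA))) :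
    Matrix (Fin (dA ^ 2)) (Fin (dA ^ 2)) ℝ :=
  Matrix.of fun i k => (dephase e (A i) * A k).trace.re

section DephasingMatrix

variable (e : OrthonormalBasis (Fin dA) ℂ (EuclideanSpace ℂ (Fin dA)))

theorem ofReal_dephasingMatrix (hA : IsObservableBasis A) (i k : Fin (dA ^ 2)) :
    ((dephasingMatrix A e i k : ℝ) : ℂ) = (dephase e (A i) * A k).trace :=
  ofReal_re_trace_mul (isHermitian_dephase e (hA.isHermitian i)) (hA.isHermitian k)

theorem transpose_dephasingMatrix : (dephasingMatrix A e)ᵀ = dephasingMatrix A e := by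
  ext i k
  simp only [dephasingMatrix, transpose_apply, of_apply]
  rw [trace_dephase_mul, trace_mul_comm]

theorem dephasingMatrix_mul_self (hA : IsObservableBasis A) :
    dephasingMatrix A e * dephasingMatrix A e = dephasingMatrix A e := by
  ext i j
  apply Complex.ofReal_injective
  rw [mul_apply, Complex.ofReal_sum, ofReal_dephasingMatrix e hA, ← dephase_dephase,
    trace_dephase_mul]
  conv_rhs => rw [hA.eq_sum (dephase e (A i))]
  rw [Finset.sum_mul, trace_sum]
  refine Finset.sum_congr rfl fun k _ => ?_
  rw [Complex.ofReal_mul, ofReal_dephasingMatrix e hA, ofReal_dephasingMatrix e hA,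
    trace_dephase_mul e (A k), Matrix.smul_mul, trace_smul, smul_eq_mul]

theorem isHermitian_measureA (hρ : ρ.IsHermitian) : (measureA e ρ).IsHermitian := by
  rw [IsHermitian, measureA, conjTranspose_sum]
  refine Finset.sum_congr rfl fun l _ => ?_
  rw [conjTranspose_mul, conjTranspose_mul,
    (isHermitian_kronecker (isHermitian_ketBra _) isHermitian_one).eq, hρ.eq, Matrix.mul_assoc]

theorem trace_measureA_mul_kronecker (X : Matrix (Fin dA) (Fin dA) ℂ)
    (Y : Matrix (Fin dB) (Fin dB) ℂ) :
    (measureA e ρ * (X ⊗ₖ Y)).trace = (ρ * (dephase e X ⊗ₖ Y)).trace := by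
  have h : dephase e X ⊗ₖ Y = ∑ l, (ketBra (e l) ⊗ₖ (1 : Matrix (Fin dB) (Fin dB) ℂ)) * (X ⊗ₖ Y) *
      (ketBra (e l) ⊗ₖ (1 : Matrix (Fin dB) (Fin dB) ℂ)) := by
    simp_rw [← mul_kronecker_mul, one_mul, mul_one]
    simpa [dephase] using sum_smul_kronecker (fun _ => (1 : ℂ))
      (fun l => ketBra (e l) * X * ketBra (e l)) Y
  rw [h]
  simp only [measureA, Finset.sum_mul, Finset.mul_sum, trace_sum]
  refine Finset.sum_congr rfl fun l _ => ?_
  rw [Matrix.mul_assoc, Matrix.mul_assoc, trace_mul_comm]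
  simp only [Matrix.mul_assoc]

/-- Measuring the first subsystem multiplies the correlation matrix by an orthogonal projection. -/
theorem correlationMatrix_measureA (hA : IsObservableBasis A) (hB : IsObservableBasis B)
    (hρ : ρ.IsHermitian) :
    correlationMatrix A B (measureA e ρ) = dephasingMatrix A e * correlationMatrix A B ρ := by
  ext i j
  apply Complex.ofReal_injective
  rw [ofReal_correlationMatrix hA hB (isHermitian_measureA e hρ), trace_measureA_mul_kronecker,
    hA.eq_sum (dephase e (A i)), sum_smul_kronecker, mul_apply, Complex.ofReal_sum, Finset.mul_sum,
    trace_sum]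
  refine Finset.sum_congr rfl fun k _ => ?_
  rw [Complex.ofReal_mul, ofReal_dephasingMatrix e hA, ofReal_correlationMatrix hA hB hρ,
    Matrix.mul_smul, trace_smul, smul_eq_mul]

theorem measureA_kronecker (X : Matrix (Fin dA) (Fin dA) ℂ) (Y : Matrix (Fin dB) (Fin dB) ℂ) :
    measureA e (X ⊗ₖ Y) = dephase e X ⊗ₖ Y := by
  simp_rw [measureA, ← mul_kronecker_mul, one_mul, mul_one]
  simpa [dephase] using (sum_smul_kronecker (fun _ => (1 : ℂ))
      (fun l => ketBra (e l) * X * ketBra (e l)) Y).symm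

end DephasingMatrix

/-! ### Classical-quantum states -/

/-- A Hermitian product operator is unchanged by measuring in an eigenbasis of its first factor. -/
theorem exists_measureA_eq_of_vecMulVec (hA : IsObservableBasis A) (hB : IsObservableBasis B)
    (hρ : ρ.IsHermitian) {a : Fin (dA ^ 2) → ℝ} {b : Fin (dB ^ 2) → ℝ}
    (h : correlationMatrix A B ρ = vecMulVec a b) :
    ∃ e : OrthonormalBasis (Fin dA) ℂ (EuclideanSpace ℂ (Fin dA)), measureA e ρ = ρ := by
  set X := ∑ i, (a i : ℂ) • A i with hX
  set Y := ∑ j, (b j : ℂ) • B j with hY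
  have hρXY : ρ = X ⊗ₖ Y := by
    rw [eq_sum_correlationMatrix hA hB hρ, h]
    ext x y
    simp [hX, hY, Matrix.sum_apply, vecMulVec_apply, Finset.sum_mul_sum]
    refine Finset.sum_congr rfl fun i _ => Finset.sum_congr rfl fun j _ => by ring
  have hXh : X.IsHermitian := by
    rw [IsHermitian, hX, conjTranspose_sum]
    refine Finset.sum_congr rfl fun i _ => ?_
    rw [conjTranspose_smul, (hA.isHermitian i).eq]
    simp
  exact ⟨hXh.eigenvectorBasis, by rw [hρXY, measureA_kronecker, dephase_eigenvectorBasis]⟩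

/-- The operator `|v⟩ ⊗ 1` from the second system to the composite system. -/
noncomputable def ketTensorOne (dB : ℕ) (v : EuclideanSpace ℂ (Fin dA)) :
    Matrix (Fin dA × Fin dB) (Fin dB) ℂ :=
  Matrix.of fun x b => if x.2 = b then v x.1 else 0

theorem ketTensorOne_mul_mul (v : EuclideanSpace ℂ (Fin dA)) (σ : Matrix (Fin dB) (Fin dB) ℂ) :
    ketTensorOne dB v * σ * (ketTensorOne dB v)ᴴ = ketBra v ⊗ₖ σ := by
  ext x y
  simp only [ketTensorOne, mul_apply, of_apply, conjTranspose_apply, ketBra]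
  simp [apply_ite star]
  ring

theorem isState_inv_trace_smul {n : Type*} [Fintype n] {M : Matrix n n ℂ} (hM : M.PosSemidef)
    (h : M.trace ≠ 0) : IsState (M.trace⁻¹ • M) :=
  ⟨hM.smul (inv_nonneg_of_nonneg hM.trace_nonneg),
    by rw [trace_smul, smul_eq_mul, inv_mul_cancel₀ h]⟩

/-- The state `τ` only serves to normalize `M = 0`. -/
theorem exists_isState_eq_smul {n : Type*} [Fintype n] {τ : Matrix n n ℂ} (hτ : IsState τ)
    {M : Matrix n n ℂ} (hM : M.PosSemidef) :
    ∃ σ, IsState σ ∧ M = ((M.trace.re : ℝ) : ℂ) • σ := by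
  have hre : ((M.trace.re : ℝ) : ℂ) = M.trace :=
    Complex.conj_eq_iff_re.1
      (Complex.conj_eq_iff_im.2 (Complex.nonneg_iff.1 hM.trace_nonneg).2.symm)
  rw [hre]
  by_cases h : M.trace = 0
  · exact ⟨τ, hτ, by rw [h, zero_smul, hM.trace_eq_zero_iff.1 h]⟩
  · exact ⟨_, isState_inv_trace_smul hM h, by rw [smul_smul, mul_inv_cancel₀ h, one_smul]⟩

/-- A state is classical-quantum if and only if some measurement does not disturb it. -/
theorem isClassicalQuantum_iff : IsClassicalQuantum ρ ↔ IsState ρ ∧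
    ∃ e : OrthonormalBasis (Fin dA) ℂ (EuclideanSpace ℂ (Fin dA)), measureA e ρ = ρ := by
  constructor
  · rintro ⟨e, q, σ, hq, hq1, hσ, rfl⟩
    refine ⟨⟨?_, ?_⟩, e, ?_⟩
    · refine posSemidef_sum _ fun i _ => ?_
      exact ((posSemidef_ketBra _).kronecker (hσ i).1).smul (by exact_mod_cast hq i)
    · simp only [trace_sum, trace_smul, trace_kronecker, trace_ketBra (e.orthonormal.1 _), (hσ _).2]
      simp only [mul_one, smul_eq_mul]
      exact_mod_cast hq1
    · have hd : ∀ i, dephase e (ketBra (e i)) = ketBra (e i) := by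
        intro i
        rw [dephase, Finset.sum_eq_single i]
        · rw [ketBra_mul_self (e.orthonormal.1 i), ketBra_mul_self (e.orthonormal.1 i)]
        · intro k _ hk
          rw [ketBra_mul_ketBra_basis, if_neg hk, Matrix.zero_mul]
        · simp
      have hlin : measureA e (∑ i, (q i : ℂ) • (ketBra (e i) ⊗ₖ σ i)) =
          ∑ i, (q i : ℂ) • measureA e (ketBra (e i) ⊗ₖ σ i) := by
        simp only [measureA, Finset.mul_sum, Finset.sum_mul, Finset.smul_sum, Matrix.mul_smul,
          Matrix.smul_mul]
        exact Finset.sum_comm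
      simp_rw [hlin, measureA_kronecker, hd]
  · rintro ⟨hρ, e, he⟩
    -- The blocks `⟨e l| ρ |e l⟩`, of which `ρ` is the block-diagonal sum.
    set M : Fin dA → Matrix (Fin dB) (Fin dB) ℂ := fun l =>
      (ketTensorOne dB (e l))ᴴ * ρ * ketTensorOne dB (e l) with hMdef
    have hM : ∀ l, (M l).PosSemidef := fun l => hρ.1.conjTranspose_mul_mul_same _
    have hsum : ρ = ∑ l, ketBra (e l) ⊗ₖ M l := by
      conv_lhs => rw [← he, measureA]
      refine Finset.sum_congr rfl fun l _ => ?_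
      rw [← ketTensorOne_mul_mul, ← ketTensorOne_mul_mul, hMdef]
      simp only [Matrix.mul_one, Matrix.mul_assoc]
    have htr : ∑ l, (M l).trace = 1 := by
      rw [← hρ.2, hsum, trace_sum]
      simp_rw [trace_kronecker, trace_ketBra (e.orthonormal.1 _), one_mul]
    obtain ⟨l₀, -, hl₀⟩ : ∃ l ∈ Finset.univ, (M l).trace ≠ 0 :=
      Finset.exists_ne_zero_of_sum_ne_zero (by rw [htr]; exact one_ne_zero)
    choose σ hσ hMσ using fun l =>
      exists_isState_eq_smul (isState_inv_trace_smul (hM l₀) hl₀) (hM l)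
    refine ⟨e, fun l => (M l).trace.re, σ, fun l => (Complex.nonneg_iff.1 (hM l).trace_nonneg).1,
      ?_, hσ, ?_⟩
    · rw [← Complex.re_sum, htr, Complex.one_re]
    · conv_lhs => rw [hsum]
      refine Finset.sum_congr rfl fun l _ => ?_
      conv_lhs => rw [hMσ l, kronecker_smul]

end CMN

/-! ### Compactness and attainment -/

namespace CMN

open Matrix

variable {dA dB : ℕ}

theorem isCompact_setOf_orthonormal (d : ℕ) :
    IsCompact {v : Fin d → EuclideanSpace ℂ (Fin d) | Orthonormal ℂ v} := by
  refine (isCompact_univ_pi fun _ => isCompact_closedBall (0 : EuclideanSpace ℂ (Fin d)) 1)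
    |>.of_isClosed_subset ?_ ?_
  · simp_rw [orthonormal_iff_ite, Set.ofPred_forall]
    exact isClosed_iInter fun i => isClosed_iInter fun j =>
      isClosed_eq (by fun_prop) continuous_const
  · intro v hv i _
    simp [hv.1 i]

theorem exists_orthonormalBasis_eq {d : ℕ} {v : Fin d → EuclideanSpace ℂ (Fin d)}
    (hv : Orthonormal ℂ v) :
    ∃ e : OrthonormalBasis (Fin d) ℂ (EuclideanSpace ℂ (Fin d)), ⇑e = v := by
  refine ⟨OrthonormalBasis.mk hv ?_, OrthonormalBasis.coe_mk _ _⟩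
  rw [hv.linearIndependent.span_eq_top_of_card_eq_finrank' (by simp)]

/-- The measurement of `measureA`, extended to arbitrary families of vectors: these form a linear
space with a topology, which `OrthonormalBasis` lacks. -/
noncomputable def measureFamily (v : Fin dA → EuclideanSpace ℂ (Fin dA))
    (ρ : Matrix (Fin dA × Fin dB) (Fin dA × Fin dB) ℂ) :
    Matrix (Fin dA × Fin dB) (Fin dA × Fin dB) ℂ :=
  ∑ l, (ketBra (v l) ⊗ₖ (1 : Matrix (Fin dB) (Fin dB) ℂ)) * ρ *
    (ketBra (v l) ⊗ₖ (1 : Matrix (Fin dB) (Fin dB) ℂ))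

theorem measureFamily_coe (e : OrthonormalBasis (Fin dA) ℂ (EuclideanSpace ℂ (Fin dA)))
    (ρ : Matrix (Fin dA × Fin dB) (Fin dA × Fin dB) ℂ) : measureFamily e ρ = measureA e ρ :=
  rfl

theorem continuous_measureFamily {X : Type*} [TopologicalSpace X]
    {f : X → Fin dA → EuclideanSpace ℂ (Fin dA)}
    {g : X → Matrix (Fin dA × Fin dB) (Fin dA × Fin dB) ℂ} (hf : Continuous f)
    (hg : Continuous g) : Continuous fun x => measureFamily (f x) (g x) := by
  have h : ∀ l, Continuous fun x => ketBra (f x l) ⊗ₖ (1 : Matrix (Fin dB) (Fin dB) ℂ) := by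
    intro l
    refine continuous_matrix fun a b => ?_
    simp only [kroneckerMap_apply, ketBra, of_apply]
    fun_prop
  exact continuous_finsetSum _ fun l _ => ((h l).matrix_mul hg).matrix_mul (h l)

theorem continuous_cmn_rpow (A : Fin (dA ^ 2) → Matrix (Fin dA) (Fin dA) ℂ)
    (B : Fin (dB ^ 2) → Matrix (Fin dB) (Fin dB) ℂ) (h : ℕ) {p : ℝ} (hp : 0 < p) :
    Continuous fun ρ => cmn A B h p ρ ^ p := by
  refine (continuous_schattenNorm_rpow hp).comp ((continuous_compoundMatrix h).comp ?_)
  refine continuous_matrix fun i j => ?_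
  simp only [correlationMatrix, of_apply]
  fun_prop

theorem exists_cmn_measureA_le (A : Fin (dA ^ 2) → Matrix (Fin dA) (Fin dA) ℂ)
    (B : Fin (dB ^ 2) → Matrix (Fin dB) (Fin dB) ℂ) (h : ℕ) {p : ℝ} (hp : 0 < p)
    (ρ : Matrix (Fin dA × Fin dB) (Fin dA × Fin dB) ℂ) :
    ∃ e, ∀ f, cmn A B h p (measureA f ρ) ^ p ≤ cmn A B h p (measureA e ρ) ^ p := by
  obtain ⟨v, hv, hmax⟩ := (isCompact_setOf_orthonormal dA).exists_isMaxOn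
    ⟨_, (EuclideanSpace.basisFun (Fin dA) ℂ).orthonormal⟩
    ((continuous_cmn_rpow A B h hp).comp
      (continuous_measureFamily continuous_id (continuous_const (y := ρ)))).continuousOn
  obtain ⟨e, rfl⟩ := exists_orthonormalBasis_eq hv
  exact ⟨e, fun f => hmax f.orthonormal⟩

theorem isClosed_setOf_isState (n : Type*) [Fintype n] :
    IsClosed {ρ : Matrix n n ℂ | IsState ρ} := by
  have h1 : IsClosed {ρ : Matrix n n ℂ | ρᴴ = ρ} := isClosed_eq (by fun_prop) continuous_id
  have h2 : IsClosed {ρ : Matrix n n ℂ | ∀ x : n → ℂ, 0 ≤ star x ⬝ᵥ (ρ *ᵥ x)} := by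
    simp_rw [Set.ofPred_forall]
    exact isClosed_iInter fun x => isClosed_le continuous_const (by fun_prop)
  have h3 : IsClosed {ρ : Matrix n n ℂ | ρ.trace = 1} := isClosed_eq (by fun_prop) continuous_const
  convert (h1.inter h2).inter h3 using 1
  ext ρ
  exact and_congr_left fun _ => posSemidef_iff_dotProduct_mulVec

theorem isClosed_setOf_isClassicalQuantum (dA dB : ℕ) :
    IsClosed {χ : Matrix (Fin dA × Fin dB) (Fin dA × Fin dB) ℂ | IsClassicalQuantum χ} := by
  let K : Set (Fin dA → EuclideanSpace ℂ (Fin dA)) := {v | Orthonormal ℂ v}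
  have : CompactSpace K := isCompact_iff_compactSpace.1 (isCompact_setOf_orthonormal dA)
  have h1 : IsClosed {x : K × Matrix (Fin dA × Fin dB) (Fin dA × Fin dB) ℂ | IsState x.2} :=
    (isClosed_setOf_isState (Fin dA × Fin dB)).preimage continuous_snd
  have h2 : IsClosed {x : K × Matrix (Fin dA × Fin dB) (Fin dA × Fin dB) ℂ |
      measureFamily x.1.1 x.2 = x.2} :=
    isClosed_eq (continuous_measureFamily (continuous_subtype_val.comp continuous_fst)
      continuous_snd) continuous_snd
  convert isClosedMap_snd_of_compactSpace _ (h1.inter h2) using 1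
  ext χ
  rw [Set.mem_ofPred_eq, isClassicalQuantum_iff, Set.mem_image]
  constructor
  · rintro ⟨hχ, e, he⟩
    rw [← measureFamily_coe] at he
    exact ⟨(⟨e, e.orthonormal⟩, χ), ⟨hχ, he⟩, rfl⟩
  · rintro ⟨⟨⟨v, hv⟩, χ⟩, ⟨hχ, he⟩, rfl⟩
    obtain ⟨e, rfl⟩ := exists_orthonormalBasis_eq hv
    exact ⟨hχ, e, (measureFamily_coe e _).symm.trans he⟩

/-- The maximally mixed state is classical-quantum. It exists as soon as there is a state at all,
since this excludes dimension zero. -/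
theorem exists_isClassicalQuantum {ρ : Matrix (Fin dA × Fin dB) (Fin dA × Fin dB) ℂ}
    (hρ : IsState ρ) : ∃ χ : Matrix (Fin dA × Fin dB) (Fin dA × Fin dB) ℂ,
      IsClassicalQuantum χ := by
  have : Nonempty (Fin dA × Fin dB) := by
    by_contra h
    rw [not_nonempty_iff] at h
    simpa [trace] using hρ.2
  have htr : (1 : Matrix (Fin dA × Fin dB) (Fin dA × Fin dB) ℂ).trace ≠ 0 := by
    rw [trace_one]
    exact_mod_cast Fintype.card_ne_zero
  refine ⟨_, isClassicalQuantum_iff.2 ⟨isState_inv_trace_smul PosSemidef.one htr,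
    EuclideanSpace.basisFun (Fin dA) ℂ, ?_⟩⟩
  rw [← one_kronecker_one, ← kronecker_smul, measureA_kronecker, dephase]
  simp_rw [mul_one, ketBra_mul_self ((EuclideanSpace.basisFun (Fin dA) ℂ).orthonormal.1 _),
    sum_ketBra]

theorem hsNormSq_eq_zero_iff {n : Type*} [Fintype n] {M : Matrix n n ℂ} :
    hsNormSq M = 0 ↔ M = 0 := by
  refine ⟨fun h => ?_, fun h => by simp [h, hsNormSq]⟩
  rw [hsNormSq, Finset.sum_eq_zero_iff_of_nonneg fun i _ => by positivity] at h
  ext i j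
  have := (Finset.sum_eq_zero_iff_of_nonneg fun j _ => by positivity).1 (h i (Finset.mem_univ i)) j
    (Finset.mem_univ j)
  simpa using this

-- The Frobenius norm induces the product topology of matrices, in which the set was proved closed.
attribute [local instance] frobeniusNormedAddCommGroup frobeniusNormedSpace in
theorem exists_isClassicalQuantum_hsNormSq_le
    {ρ : Matrix (Fin dA × Fin dB) (Fin dA × Fin dB) ℂ} (hρ : IsState ρ) :
    ∃ χ, IsClassicalQuantum χ ∧
      ∀ χ', IsClassicalQuantum χ' → hsNormSq (ρ - χ) ≤ hsNormSq (ρ - χ') := by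
  have hnorm : ∀ M : Matrix (Fin dA × Fin dB) (Fin dA × Fin dB) ℂ, hsNormSq M = ‖M‖ ^ 2 := by
    intro M
    rw [frobenius_norm_def, hsNormSq, ← Real.rpow_natCast, ← Real.rpow_mul (by positivity)]
    simp
  have : ProperSpace (Matrix (Fin dA × Fin dB) (Fin dA × Fin dB) ℂ) := FiniteDimensional.proper ℂ _
  obtain ⟨χ, hχ, hmin⟩ := (isClosed_setOf_isClassicalQuantum dA dB).exists_infDist_eq_dist
    (exists_isClassicalQuantum hρ) ρ
  refine ⟨χ, hχ, fun χ' hχ' => ?_⟩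
  rw [hnorm, hnorm, ← dist_eq_norm, ← dist_eq_norm, ← hmin]
  gcongr
  · exact Metric.infDist_nonneg
  · exact Metric.infDist_le_dist_of_mem hχ'

theorem geometricDiscord_eq_zero_iff {ρ : Matrix (Fin dA × Fin dB) (Fin dA × Fin dB) ℂ}
    (hρ : IsState ρ) : geometricDiscord ρ = 0 ↔ IsClassicalQuantum ρ := by
  obtain ⟨χ, hχ, hmin⟩ := exists_isClassicalQuantum_hsNormSq_le hρ
  have hval : IsLeast (Set.range fun χ : {χ // IsClassicalQuantum χ} => hsNormSq (ρ - χ.1))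
      (hsNormSq (ρ - χ)) :=
    ⟨⟨⟨χ, hχ⟩, rfl⟩, by rintro _ ⟨χ', rfl⟩; exact hmin χ'.1 χ'.2⟩
  have : geometricDiscord ρ = hsNormSq (ρ - χ) := hval.csInf_eq
  rw [this]
  constructor
  · intro h
    rwa [sub_eq_zero.1 (hsNormSq_eq_zero_iff.1 h)]
  · intro h
    refine le_antisymm ((hmin ρ h).trans_eq ?_) ?_
    · rw [sub_self, hsNormSq_eq_zero_iff]
    · exact Finset.sum_nonneg fun i _ => Finset.sum_nonneg fun j _ => by positivity

/-! ### The discord -/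

theorem cmn_measureA_eq {A : Fin (dA ^ 2) → Matrix (Fin dA) (Fin dA) ℂ}
    {B : Fin (dB ^ 2) → Matrix (Fin dB) (Fin dB) ℂ} (hA : IsObservableBasis A)
    (hB : IsObservableBasis B) {ρ : Matrix (Fin dA × Fin dB) (Fin dA × Fin dB) ℂ}
    (hρ : ρ.IsHermitian) (h : ℕ) (p : ℝ)
    (e : OrthonormalBasis (Fin dA) ℂ (EuclideanSpace ℂ (Fin dA))) :
    cmn A B h p (measureA e ρ) = schattenNorm p
      (compoundMatrix h (dephasingMatrix A e) * compoundMatrix h (correlationMatrix A B ρ)) := by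
  rw [cmn, correlationMatrix_measureA e hA hB hρ, compoundMatrix_mul]

theorem cmn_measureA_rpow_le {A : Fin (dA ^ 2) → Matrix (Fin dA) (Fin dA) ℂ}
    {B : Fin (dB ^ 2) → Matrix (Fin dB) (Fin dB) ℂ} (hA : IsObservableBasis A)
    (hB : IsObservableBasis B) {ρ : Matrix (Fin dA × Fin dB) (Fin dA × Fin dB) ℂ}
    (hρ : ρ.IsHermitian) (h : ℕ) {p : ℝ} (hp : 0 < p)
    (e : OrthonormalBasis (Fin dA) ℂ (EuclideanSpace ℂ (Fin dA))) :
    cmn A B h p (measureA e ρ) ^ p ≤ cmn A B h p ρ ^ p := by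
  rw [cmn_measureA_eq hA hB hρ]
  exact schattenNorm_mul_rpow_le hp
    (by rw [transpose_compoundMatrix, transpose_dephasingMatrix])
    (by rw [← compoundMatrix_mul, dephasingMatrix_mul_self e hA]) _

/-- If some measurement preserves the Correlation Minor Norm of order one or two, then some
measurement, possibly another one, leaves the state undisturbed. For order two the exception is a
correlation matrix of rank one, that is, a product state. -/
theorem exists_measureA_eq_of_cmn_eq {A : Fin (dA ^ 2) → Matrix (Fin dA) (Fin dA) ℂ}
    {B : Fin (dB ^ 2) → Matrix (Fin dB) (Fin dB) ℂ} (hA : IsObservableBasis A)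
    (hB : IsObservableBasis B) {ρ : Matrix (Fin dA × Fin dB) (Fin dA × Fin dB) ℂ}
    (hρ : ρ.IsHermitian) {h : ℕ} (hh : 1 ≤ h) (hh2 : h ≤ 2) {p : ℝ} (hp : 0 < p)
    {e : OrthonormalBasis (Fin dA) ℂ (EuclideanSpace ℂ (Fin dA))}
    (heq : cmn A B h p (measureA e ρ) ^ p = cmn A B h p ρ ^ p) :
    ∃ f : OrthonormalBasis (Fin dA) ℂ (EuclideanSpace ℂ (Fin dA)), measureA f ρ = ρ := by
  rw [cmn_measureA_eq hA hB hρ] at heq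
  have hC := mul_eq_self_of_schattenNorm_rpow_eq hp
    (by rw [transpose_compoundMatrix, transpose_dephasingMatrix])
    (by rw [← compoundMatrix_mul, dephasingMatrix_mul_self e hA]) _ heq
  rw [← compoundMatrix_mul] at hC
  have hfix : dephasingMatrix A e * correlationMatrix A B ρ = correlationMatrix A B ρ →
      measureA e ρ = ρ := fun h =>
    correlationMatrix_injective hA hB (isHermitian_measureA e hρ) hρ
      (by rw [correlationMatrix_measureA e hA hB hρ, h])
  obtain rfl | rfl : h = 1 ∨ h = 2 := by omega
  · exact ⟨e, hfix (eq_of_compoundMatrix_one_eq hC)⟩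
  · rcases mul_eq_self_or_exists_vecMulVec (dephasingMatrix_mul_self e hA) hC with h | ⟨a, b, h⟩
    · exact ⟨e, hfix h⟩
    · exact exists_measureA_eq_of_vecMulVec hA hB hρ h

end CMN

theorem theorem5 (dA dB : ℕ)
    (A : Fin (dA ^ 2) → Matrix (Fin dA) (Fin dA) ℂ) (hA : CMN.IsObservableBasis A)
    (B : Fin (dB ^ 2) → Matrix (Fin dB) (Fin dB) ℂ) (hB : CMN.IsObservableBasis B)
    (ρ : Matrix (Fin dA × Fin dB) (Fin dA × Fin dB) ℂ) (hρ : CMN.IsState ρ)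
    (h : ℕ) (hh : 1 ≤ h) (hh' : h ≤ min (dA ^ 2) (dB ^ 2)) (p : ℝ) (hp : 1 ≤ p) :
    -- the maximum in the definition of the discord is attained
    (∃ e, ∀ f, CMN.cmn A B h p (CMN.measureA f ρ) ^ p ≤ CMN.cmn A B h p (CMN.measureA e ρ) ^ p) ∧
    -- the minimum in the definition of the geometric discord is attained
    (∃ χ, CMN.IsClassicalQuantum χ ∧
      ∀ χ', CMN.IsClassicalQuantum χ' → CMN.hsNormSq (ρ - χ) ≤ CMN.hsNormSq (ρ - χ')) ∧
    0 ≤ CMN.cmnDiscord A B h p ρ ∧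
    (h ≤ 2 → (CMN.cmnDiscord A B h p ρ = 0 ↔ CMN.geometricDiscord ρ = 0)) := by
  have hp0 : 0 < p := one_pos.trans_le hp
  have hherm := hρ.1.isHermitian
  obtain ⟨e, he⟩ := CMN.exists_cmn_measureA_le A B h hp0 ρ
  have hsup : IsGreatest (Set.range fun f => CMN.cmn A B h p (CMN.measureA f ρ) ^ p)
      (CMN.cmn A B h p (CMN.measureA e ρ) ^ p) :=
    ⟨⟨e, rfl⟩, by rintro _ ⟨f, rfl⟩; exact he f⟩
  have hval : CMN.cmnDiscord A B h p ρ =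
      CMN.cmn A B h p ρ ^ p - CMN.cmn A B h p (CMN.measureA e ρ) ^ p :=
    congrArg _ hsup.csSup_eq
  have hle := CMN.cmn_measureA_rpow_le hA hB hherm h hp0 e
  refine ⟨⟨e, he⟩, CMN.exists_isClassicalQuantum_hsNormSq_le hρ, ?_, fun hh2 => ?_⟩
  · rw [hval]
    exact sub_nonneg.2 hle
  · rw [CMN.geometricDiscord_eq_zero_iff hρ, CMN.isClassicalQuantum_iff, and_iff_right hρ, hval,
      sub_eq_zero]
    constructor
    · exact fun heq => CMN.exists_measureA_eq_of_cmn_eq hA hB hherm hh hh2 hp0 heq.symm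
    · rintro ⟨f, hf⟩
      have := he f
      rw [hf] at this
      exact this.antisymm hle
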